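/- Let $d\ge 1$, let $\mathcal M_d$ be the complex $d\times d$ matrices and let $T:\mathcal M_d\to\mathcal M_d$ be a doubly stochastic quantum channel, i.e. a completely positive, trace preserving linear map with $T(\mathbb 1_d)=T^*(\mathbb 1_d)=\mathbb 1_d$, where $T^*$ is the adjoint with respect to the Hilbert–Schmidt scalar product. Suppose that $T^*T$ is primitive, i.e. $\lim_{n\to\infty}(T^*T)^n(\rho)=\mathbb 1_d/d$ for every density matrix $\rho\in\mathcal M_d$. Define the discrete logarithmic Sobolev constant $$\alpha_D(T)=\frac12\,\inf_X\frac{\mathcal E(X)}{\mathrm{Ent}_2(X)},\qquad \mathcal E(X)=-\frac1d\operatorname{tr}\big[(T^*T-\mathrm{id})(X)\,X\big],\qquad \mathrm{Ent}_2(X)=\frac1{2d}\operatorname{tr}\Big[X^2\Big(\log\frac{X^2}{\operatorname{tr}(X^2)}+\log d\Big)\Big],$$ where the infimum is over all strictly positive $X\in\mathcal M_d$ with $\mathrm{Ent}_2(X)\neq 0$, i.e. that are not multiples of $\mathbb 1_d$ (it is $+\infty$ if there are none, that is, if $d=1$). For $1\le p<\infty$ let $\|Y\|_{p,\mathbb 1_d/d}=d^{-1/p}(\operatorname{tr}|Y|^p)^{1/p}$,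 where $|Y|=(Y^\dagger Y)^{1/2}$, and put $$\|T\|_{2\to q,\mathbb 1_d/d}=\sup_{0\ne Y\in\mathcal M_d}\frac{\|T(Y)\|_{q,\mathbb 1_d/d}}{\|Y\|_{2,\mathbb 1_d/d}}.$$ Then $\|T\|_{2\to q,\mathbb 1_d/d}\le 1$ for every real $q\ge 1$ with $q\le 2+2\alpha_D(T)$. -/

import Mathlib

open scoped ENNReal ComplexOrder

namespace QHyper

/-- The complex `d × d` matrices. -/
abbrev Mat (d : ℕ) : Type := Matrix (Fin d) (Fin d) ℂ

/-- The map `id_k ⊗ T` on `M_k ⊗ M_d`, i.e. `T` applied to each of the `k²` blocks. -/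
def ampliation {d : ℕ} (T : Mat d →ₗ[ℂ] Mat d) (k : ℕ)
    (A : Matrix (Fin k × Fin d) (Fin k × Fin d) ℂ) :
    Matrix (Fin k × Fin d) (Fin k × Fin d) ℂ :=
  Matrix.of fun x y => T (Matrix.of fun i j => A (x.1, i) (y.1, j)) x.2 y.2

/-- Complete positivity: every `id_k ⊗ T` maps positive semidefinite matrices to positive
semidefinite matrices. -/
def IsCompletelyPositive {d : ℕ} (T : Mat d →ₗ[ℂ] Mat d) : Prop :=
  ∀ (k : ℕ) (A : Matrix (Fin k × Fin d) (Fin k × Fin d) ℂ),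
    A.PosSemidef → (ampliation T k A).PosSemidef

/-- A quantum channel: a completely positive, trace preserving linear map. -/
structure IsQuantumChannel {d : ℕ} (T : Mat d →ₗ[ℂ] Mat d) : Prop where
  completelyPositive : IsCompletelyPositive T
  trace_preserving : ∀ X : Mat d, (T X).trace = X.trace

/-- The adjoint `T*` with respect to the Hilbert-Schmidt scalar product `⟨X, Y⟩ = tr (Xᴴ Y)`,
given by its entries `(T* Y)_{ij} = ⟨E_{ij}, T* Y⟩ = ⟨T E_{ij}, Y⟩`; see `trace_hsAdjoint` for
the defining property. -/
def hsAdjoint {d : ℕ} (T : Mat d →ₗ[ℂ] Mat d) : Mat d →ₗ[ℂ] Mat d where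
  toFun Y := Matrix.of fun i j => ((T (Matrix.single i j 1)).conjTranspose * Y).trace
  map_add' Y Z := by
    ext i j
    simp [Matrix.mul_add]
  map_smul' c Y := by
    ext i j
    simp

theorem trace_hsAdjoint {d : ℕ} (T : Mat d →ₗ[ℂ] Mat d) (X Y : Mat d) :
    (X.conjTranspose * hsAdjoint T Y).trace = ((T X).conjTranspose * Y).trace := by
  have hX : T X = ∑ i, ∑ j, X i j • T (Matrix.single i j 1) := by
    conv_lhs => rw [Matrix.matrix_eq_sum_single X]
    rw [map_sum]
    refine Finset.sum_congr rfl fun i _ => ?_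
    rw [map_sum]
    refine Finset.sum_congr rfl fun j _ => ?_
    rw [← map_smul, Matrix.smul_single, smul_eq_mul, mul_one]
  rw [hX]
  simp only [Matrix.conjTranspose_sum, Matrix.conjTranspose_smul, Matrix.sum_mul,
    Matrix.smul_mul, Matrix.trace_sum, Matrix.trace_smul]
  rw [Finset.sum_comm]
  simp [Matrix.trace, Matrix.mul_apply, hsAdjoint]

/-- A doubly stochastic quantum channel: `T(1) = T*(1) = 1`. -/
structure IsDoublyStochasticChannel {d : ℕ} (T : Mat d →ₗ[ℂ] Mat d) : Prop where
  channel : IsQuantumChannel T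
  map_one : T 1 = 1
  adjoint_map_one : hsAdjoint T 1 = 1

/-- Density matrices. -/
def IsState {d : ℕ} (ρ : Mat d) : Prop := ρ.PosSemidef ∧ ρ.trace = 1

/-- Primitivity of a doubly stochastic channel `P`: `Pⁿ(ρ) → 1/d` for every state `ρ`. -/
def IsPrimitive {d : ℕ} (P : Mat d →ₗ[ℂ] Mat d) : Prop :=
  ∀ ρ : Mat d, IsState ρ →
    Filter.Tendsto (fun n : ℕ => (P ^ n) ρ) Filter.atTop (nhds ((d : ℂ)⁻¹ • (1 : Mat d)))

/-- The 2-Dirichlet form `-(1/d) tr[L(X) X]` of a linear map `L`. -/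
noncomputable def dirichlet2 {d : ℕ} (L : Mat d →ₗ[ℂ] Mat d) (X : Mat d) : ℝ :=
  -(1 / (d : ℝ)) * (L X * X).trace.re

/-- The 2-relative entropy `(1/(2d)) tr[X² (log (X² / tr X²) + log d)]`, for strictly positive
`X`; the matrix logarithm is taken through the continuous functional calculus. -/
noncomputable def ent2 {d : ℕ} (X : Mat d) : ℝ :=
  1 / (2 * (d : ℝ)) *
    (X ^ 2 * (cfc Real.log (((X ^ 2).trace)⁻¹ • X ^ 2) + Real.log d • (1 : Mat d))).trace.re

/-- The LS-2 constant: the infimum of `dirichlet2 L X / ent2 X` over all strictly positive `X`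
for which the quotient makes sense, i.e. those which are not multiples of the identity. It is an
infimum of extended reals, so it is `⊤` if there is no such `X` (which happens for `d = 1`). -/
noncomputable def ls2Const {d : ℕ} (L : Mat d →ₗ[ℂ] Mat d) : EReal :=
  ⨅ (X : Mat d) (_ : X.PosDef ∧ ent2 X ≠ 0), ((dirichlet2 L X / ent2 X : ℝ) : EReal)

/-- The discrete LS constant `α_D(T) = (1/2) α_2(T*T - id)`. -/
noncomputable def discreteLSConst {d : ℕ} (T : Mat d →ₗ[ℂ] Mat d) : EReal :=
  ((1 / 2 : ℝ) : EReal) * ls2Const (hsAdjoint T ∘ₗ T - LinearMap.id)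

/-- The absolute value `|Y| = (Yᴴ Y)^{1/2}`. -/
noncomputable def matAbs {d : ℕ} (Y : Mat d) : Mat d :=
  cfc Real.sqrt (Y.conjTranspose * Y)

/-- The `1/d`-weighted `p`-norm `d^{-1/p} (tr |Y|^p)^{1/p}`. -/
noncomputable def wnorm {d : ℕ} (p : ℝ) (Y : Mat d) : ℝ :=
  1 / (d : ℝ) ^ (1 / p) * (cfc (fun s : ℝ => s ^ p) (matAbs Y)).trace.re ^ (1 / p)

/-- The `p → q` norm of `T` with respect to the weighted norms, as a supremum over all nonzero
complex matrices. -/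
noncomputable def opNorm {d : ℕ} (p q : ℝ) (T : Mat d →ₗ[ℂ] Mat d) : ℝ≥0∞ :=
  ⨆ (Y : Mat d) (_ : Y ≠ 0), ENNReal.ofReal (wnorm q (T Y) / wnorm p Y)

end QHyper

namespace QHyper

open Matrix

/-! Two reductions lead to scalar inequalities. For `Y` with polar parts `|Y*|` and `|Y|`, complete
positivity applied to the block matrix with blocks `|Y*|`, `Y`, `Y*`, `|Y|` bounds each singular
value of `T Y` by the geometric mean of diagonal entries of `T |Y*|` and `T |Y|`
(`singularValue_sq_le`). It therefore suffices to bound the diagonal of `T X`, in any orthonormal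
basis, for `X > 0` (`sum_rpow_diagEntry_le`).

Such a diagonal entry is a probability average of the eigenvalues of `X`. If `q ≤ 2`, Jensen and the
power mean inequality suffice. If `q > 2`, Jensen with exponent `q/2` passes to `‖T (X^(q/2))‖₂²`;
the log-Sobolev inequality at `X^(q/2)` bounds this by `‖X^(q/2)‖₂²` minus an entropy term
(`logSobolev_conjDiag`), and that term pays for replacing the `q`-norm of `X` by its `2`-norm
(`entropy_le_of_pos`). -/

/-! ### Functional calculus and singular values. -/

/-- The algebra homomorphism `g ↦ U diag(g) U*`. -/
noncomputable def conjDiag {d : ℕ} (U : unitaryGroup (Fin d) ℂ) : (Fin d → ℝ) →ₐ[ℝ] Mat d :=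
  ((Unitary.conjStarAlgAut ℝ (Mat d) U : Mat d →⋆ₐ[ℝ] Mat d) : Mat d →ₐ[ℝ] Mat d).comp
    ((diagonalAlgHom ℝ).comp (Complex.ofRealAm.compLeft (Fin d)))

theorem conjDiag_apply {d : ℕ} (U : unitaryGroup (Fin d) ℂ) (g : Fin d → ℝ) :
    conjDiag U g = (U : Mat d) * diagonal (fun i => (g i : ℂ)) * (U : Mat d)ᴴ := by
  rfl

theorem conjTranspose_mul_unitary {d : ℕ} (U : unitaryGroup (Fin d) ℂ) :
    (U : Mat d)ᴴ * (U : Mat d) = 1 :=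
  Unitary.coe_star_mul_self U

theorem unitary_mul_conjTranspose {d : ℕ} (U : unitaryGroup (Fin d) ℂ) :
    (U : Mat d) * (U : Mat d)ᴴ = 1 :=
  Unitary.coe_mul_star_self U

theorem isHermitian_conjDiag {d : ℕ} (U : unitaryGroup (Fin d) ℂ) (g : Fin d → ℝ) :
    (conjDiag U g).IsHermitian := by
  rw [conjDiag_apply]
  refine isHermitian_mul_mul_conjTranspose _ ?_
  rw [IsHermitian, diagonal_conjTranspose]
  congr 1
  ext i
  simp

theorem posSemidef_conjDiag {d : ℕ} (U : unitaryGroup (Fin d) ℂ) {g : Fin d → ℝ}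
    (hg : ∀ i, 0 ≤ g i) : (conjDiag U g).PosSemidef := by
  rw [conjDiag_apply]
  refine PosSemidef.mul_mul_conjTranspose_same (posSemidef_diagonal_iff.2 fun i => ?_) _
  exact_mod_cast hg i

theorem posDef_conjDiag {d : ℕ} (U : unitaryGroup (Fin d) ℂ) {g : Fin d → ℝ}
    (hg : ∀ i, 0 < g i) : (conjDiag U g).PosDef := by
  rw [conjDiag_apply]
  refine (IsUnit.posDef_star_right_conjugate_iff (Unitary.toUnits U).isUnit).2 ?_
  refine posDef_diagonal_iff.2 fun i => ?_
  exact_mod_cast hg i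

theorem trace_conjDiag {d : ℕ} (U : unitaryGroup (Fin d) ℂ) (g : Fin d → ℝ) :
    (conjDiag U g).trace = ((∑ i, g i : ℝ) : ℂ) := by
  rw [conjDiag_apply, trace_mul_comm, ← Matrix.mul_assoc, conjTranspose_mul_unitary, Matrix.one_mul,
    trace_diagonal]
  push_cast
  rfl

/-- The spectrum is finite, so `f` agrees on it with an interpolating polynomial, and polynomials
commute with algebra homomorphisms. No continuity of `f` is needed. -/
theorem cfc_conjDiag {d : ℕ} (U : unitaryGroup (Fin d) ℂ) (f : ℝ → ℝ) (g : Fin d → ℝ) :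
    cfc f (conjDiag U g) = conjDiag U (fun i => f (g i)) := by
  classical
  have hA : IsSelfAdjoint (conjDiag U g) := isHermitian_conjDiag U g
  have hfin : (spectrum ℝ (conjDiag U g)).Finite := Matrix.finite_real_spectrum
  let s : Finset ℝ := hfin.toFinset ∪ Finset.univ.image g
  let p : Polynomial ℝ := Lagrange.interpolate s id f
  have hp : ∀ x ∈ s, p.eval x = f x := fun x hx =>
    Lagrange.eval_interpolate_at_node f (v := id) (Set.injOn_id _) hx
  have h1 : cfc f (conjDiag U g) = cfc p.eval (conjDiag U g) :=
    cfc_congr fun x hx => (hp x (by simp [s, hx])).symm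
  rw [h1, cfc_polynomial p _ hA, Polynomial.aeval_algHom_apply]
  congr 1
  ext i
  rw [← hp (g i) (by simp [s])]
  change (Pi.evalAlgHom ℝ (fun _ : Fin d => ℝ) i) (Polynomial.aeval g p) = _
  rw [← Polynomial.aeval_algHom_apply]
  simp

theorem exists_singularValueDecomposition {d : ℕ} (Y : Mat d) :
    ∃ (W V : unitaryGroup (Fin d) ℂ) (s : Fin d → ℝ), (∀ i, 0 ≤ s i) ∧
      Y = (W : Mat d) * diagonal (fun i => (s i : ℂ)) * (V : Mat d)ᴴ := by
  have hY : (Yᴴ * Y).PosSemidef := posSemidef_conjTranspose_mul_self Y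
  let V := hY.isHermitian.eigenvectorUnitary
  let l := hY.isHermitian.eigenvalues
  have hl : ∀ i, 0 ≤ l i := hY.eigenvalues_nonneg
  let s : Fin d → ℝ := fun i => Real.sqrt (l i)
  let C : Mat d := Y * (V : Mat d)
  have hC : Cᴴ * C = diagonal (fun i => (l i : ℂ)) := by
    have h := hY.isHermitian.spectral_theorem
    have h' : Yᴴ * Y = (V : Mat d) * diagonal (fun i => (l i : ℂ)) * (V : Mat d)ᴴ := h
    calc Cᴴ * C = (V : Mat d)ᴴ * (Yᴴ * Y) * V := by
          simp only [C, conjTranspose_mul, Matrix.mul_assoc]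
      _ = ((V : Mat d)ᴴ * V) * diagonal (fun i => (l i : ℂ)) * ((V : Mat d)ᴴ * V) := by
          rw [h']; simp only [Matrix.mul_assoc]
      _ = _ := by rw [conjTranspose_mul_unitary, Matrix.one_mul, Matrix.mul_one]
  have hinner : ∀ i j, ∑ k, star (C k i) * C k j = if i = j then (l i : ℂ) else 0 := by
    intro i j
    have := congrFun (congrFun hC i) j
    rw [Matrix.mul_apply, diagonal_apply] at this
    simpa [conjTranspose_apply] using this
  -- The columns of `C = Y V` are orthogonal with squared lengths `l i`. The nonzero ones are
  -- normalised and extended to an orthonormal basis, which gives the left unitary.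
  let v : Fin d → EuclideanSpace ℂ (Fin d) := fun i => WithLp.toLp 2 fun k => ((s i)⁻¹ : ℂ) * C k i
  let S : Set (Fin d) := {i | l i ≠ 0}
  have hv : Orthonormal ℂ (S.domRestrict v) := by
    rw [orthonormal_iff_ite]
    rintro ⟨i, hi⟩ ⟨j, hj⟩
    have h1 : inner ℂ (v i) (v j) = ((s i)⁻¹ : ℂ) * (s j)⁻¹ * ∑ k, star (C k i) * C k j := by
      simp only [v, PiLp.inner_apply, RCLike.inner_apply, Finset.mul_sum]
      refine Finset.sum_congr rfl fun k _ => ?_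
      simp
      ring
    change inner ℂ (v i) (v j) = _
    rw [h1, hinner]
    by_cases hij : i = j
    · subst hij
      have hs : s i * s i = l i := Real.mul_self_sqrt (hl i)
      have hne : s i ≠ 0 := fun h => hi (by rw [← hs, h, mul_zero])
      have hne' : (s i : ℂ) ≠ 0 := by exact_mod_cast hne
      simp only [if_true]
      rw [← hs]
      push_cast
      field_simp
    · simp [hij]
  obtain ⟨b, hb⟩ := hv.exists_orthonormalBasis_extension_of_card_eq (by simp)
  let W₀ : Mat d := Matrix.of fun k i => b i k
  have hW₀ : W₀ ∈ unitaryGroup (Fin d) ℂ := by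
    rw [mem_unitaryGroup_iff']
    ext i j
    have h := orthonormal_iff_ite.1 b.orthonormal i j
    rw [star_eq_conjTranspose, Matrix.mul_apply, Matrix.one_apply]
    rw [← h, PiLp.inner_apply]
    refine Finset.sum_congr rfl fun k _ => ?_
    simp [W₀, mul_comm]
  have hCW : C = W₀ * diagonal (fun i => (s i : ℂ)) := by
    ext k i
    rw [mul_diagonal]
    by_cases hi : l i = 0
    · have h0 := hinner i i
      simp only [if_true, hi, Complex.ofReal_zero] at h0
      have h1 := (Finset.sum_eq_zero_iff_of_nonneg (fun k _ => star_mul_self_nonneg (C k i))).1 h0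
        k (Finset.mem_univ k)
      have h2 : C k i = 0 := by simpa using h1
      rw [h2]
      simp [s, hi]
    · have hs : s i * s i = l i := Real.mul_self_sqrt (hl i)
      have hne : s i ≠ 0 := fun h => hi (by rw [← hs, h, mul_zero])
      have hne' : (s i : ℂ) ≠ 0 := by exact_mod_cast hne
      have : W₀ k i = ((s i)⁻¹ : ℂ) * C k i := by
        change b i k = _
        rw [hb i hi]
      rw [this]
      field_simp
  refine ⟨⟨W₀, hW₀⟩, V, s, fun i => Real.sqrt_nonneg _, ?_⟩
  change Y = W₀ * diagonal (fun i => (s i : ℂ)) * (V : Mat d)ᴴ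
  rw [← hCW]
  simp only [C]
  rw [Matrix.mul_assoc, unitary_mul_conjTranspose, Matrix.mul_one]

theorem wnorm_eq {d : ℕ} (p : ℝ) (W V : unitaryGroup (Fin d) ℂ) {s : Fin d → ℝ}
    (hs : ∀ i, 0 ≤ s i) :
    wnorm p ((W : Mat d) * diagonal (fun i => (s i : ℂ)) * (V : Mat d)ᴴ) =
      1 / (d : ℝ) ^ (1 / p) * (∑ i, s i ^ p) ^ (1 / p) := by
  have h : ((W : Mat d) * diagonal (fun i => (s i : ℂ)) * (V : Mat d)ᴴ)ᴴ *
      ((W : Mat d) * diagonal (fun i => (s i : ℂ)) * (V : Mat d)ᴴ) =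
      conjDiag V (fun i => s i * s i) := by
    have hD : (diagonal (fun i => (s i : ℂ)))ᴴ = diagonal (fun i => (s i : ℂ)) := by
      rw [diagonal_conjTranspose]
      congr 1
      ext i
      simp
    rw [conjDiag_apply, conjTranspose_mul, conjTranspose_mul, conjTranspose_conjTranspose, hD]
    calc _ = (V : Mat d) * (diagonal (fun i => (s i : ℂ)) * ((W : Mat d)ᴴ * W) *
          diagonal (fun i => (s i : ℂ))) * (V : Mat d)ᴴ := by simp only [Matrix.mul_assoc]
      _ = _ := by
        rw [conjTranspose_mul_unitary, Matrix.mul_one, diagonal_mul_diagonal]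
        push_cast
        rfl
  rw [wnorm, matAbs, h, cfc_conjDiag, cfc_conjDiag, trace_conjDiag, Complex.ofReal_re]
  simp only [Real.sqrt_mul_self (hs _)]

/-! ### Diagonal entries of the image as averages of eigenvalues. -/

/-- A positive unital functional on `Fin d → ℝ` is a probability vector. -/
theorem jensen_of_monotone {d : ℕ} (ω : (Fin d → ℝ) →ₗ[ℝ] ℝ) (hω : ∀ g, (∀ i, 0 ≤ g i) → 0 ≤ ω g)
    (h1 : ω 1 = 1) {f : ℝ → ℝ} (hf : ConvexOn ℝ (Set.Ici 0) f) {g : Fin d → ℝ}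
    (hg : ∀ i, 0 ≤ g i) : f (ω g) ≤ ω (fun i => f (g i)) := by
  have key : ∀ h : Fin d → ℝ, ω h = ∑ k, ω (Pi.single k 1) • h k := by
    intro h
    conv_lhs => rw [pi_eq_sum_univ' h]
    rw [map_sum]
    refine Finset.sum_congr rfl fun k _ => ?_
    rw [map_smul, smul_eq_mul, smul_eq_mul, mul_comm]
  rw [key g, key fun i => f (g i)]
  refine hf.map_sum_le (fun k _ => hω _ fun i => ?_) ?_ fun k _ => hg k
  · by_cases h : i = k
    · subst h; simp
    · simp [h]
  · have := key 1
    simpa [h1] using this.symm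

theorem isHermitian_of_map_posSemidef {d : ℕ} {T : Mat d →ₗ[ℂ] Mat d}
    (hT : ∀ A : Mat d, A.PosSemidef → (T A).PosSemidef) (U : unitaryGroup (Fin d) ℂ)
    {g : Fin d → ℝ} (hg : ∀ i, 0 ≤ g i) : (T (conjDiag U g)).IsHermitian :=
  (hT _ (posSemidef_conjDiag U hg)).isHermitian

/-- The diagonal entry `re (W* T(U diag(g) U*) W)_{ii}` as a linear functional of `g`. -/
noncomputable def diagEntry {d : ℕ} (T : Mat d →ₗ[ℂ] Mat d) (U W : unitaryGroup (Fin d) ℂ)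
    (i : Fin d) : (Fin d → ℝ) →ₗ[ℝ] ℝ where
  toFun g := (((W : Mat d)ᴴ * T (conjDiag U g) * (W : Mat d)) i i).re
  map_add' g h := by
    simp only [map_add, Matrix.mul_add, Matrix.add_mul, Matrix.add_apply, Complex.add_re]
  map_smul' c g := by
    have : T (conjDiag U (c • g)) = (c : ℂ) • T (conjDiag U g) := by
      rw [map_smul (conjDiag U), ← map_smul T]
      congr 1
    rw [this]
    simp

theorem diagEntry_apply {d : ℕ} (T : Mat d →ₗ[ℂ] Mat d) (U W : unitaryGroup (Fin d) ℂ)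
    (i : Fin d) (g : Fin d → ℝ) :
    diagEntry T U W i g = (((W : Mat d)ᴴ * T (conjDiag U g) * (W : Mat d)) i i).re :=
  rfl

theorem diagEntry_nonneg {d : ℕ} {T : Mat d →ₗ[ℂ] Mat d}
    (hT : ∀ A : Mat d, A.PosSemidef → (T A).PosSemidef) (U W : unitaryGroup (Fin d) ℂ) (i : Fin d)
    {g : Fin d → ℝ} (hg : ∀ i, 0 ≤ g i) : 0 ≤ diagEntry T U W i g :=
  (Complex.nonneg_iff.1 (((hT _ (posSemidef_conjDiag U hg)).conjTranspose_mul_mul_same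
    (W : Mat d)).diag_nonneg)).1

theorem diagEntry_one {d : ℕ} {T : Mat d →ₗ[ℂ] Mat d} (h1 : T 1 = 1)
    (U W : unitaryGroup (Fin d) ℂ) (i : Fin d) : diagEntry T U W i 1 = 1 := by
  rw [diagEntry_apply, map_one, h1, Matrix.mul_one, conjTranspose_mul_unitary]
  simp

theorem sum_diagEntry {d : ℕ} {T : Mat d →ₗ[ℂ] Mat d} (htr : ∀ X : Mat d, (T X).trace = X.trace)
    (U W : unitaryGroup (Fin d) ℂ) (g : Fin d → ℝ) : ∑ i, diagEntry T U W i g = ∑ i, g i := by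
  have h : ((W : Mat d)ᴴ * T (conjDiag U g) * (W : Mat d)).trace = ((∑ i, g i : ℝ) : ℂ) := by
    rw [trace_mul_comm, ← Matrix.mul_assoc, unitary_mul_conjTranspose, Matrix.one_mul, htr,
      trace_conjDiag]
  have h' := congrArg Complex.re h
  rw [Complex.ofReal_re, trace, Complex.re_sum] at h'
  exact h'

theorem sum_sq_diagEntry_le {d : ℕ} (T : Mat d →ₗ[ℂ] Mat d) (U W : unitaryGroup (Fin d) ℂ)
    (g : Fin d → ℝ) :
    ∑ i, diagEntry T U W i g ^ 2 ≤ ((T (conjDiag U g))ᴴ * T (conjDiag U g)).trace.re := by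
  set B := T (conjDiag U g) with hB
  set M := (W : Mat d)ᴴ * B * (W : Mat d) with hM
  have h : (Bᴴ * B).trace = (Mᴴ * M).trace := by
    rw [hM, conjTranspose_mul, conjTranspose_mul, conjTranspose_conjTranspose]
    calc (Bᴴ * B).trace = ((W : Mat d) * (W : Mat d)ᴴ * (Bᴴ * B)).trace := by
          rw [unitary_mul_conjTranspose, Matrix.one_mul]
      _ = ((W : Mat d)ᴴ * (Bᴴ * 1 * B) * W).trace := by
          rw [Matrix.mul_assoc, trace_mul_comm, Matrix.mul_one]
      _ = _ := by
          rw [← unitary_mul_conjTranspose W]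
          simp only [Matrix.mul_assoc]
  rw [h, trace, Complex.re_sum]
  refine Finset.sum_le_sum fun i _ => ?_
  rw [diag_apply, Matrix.mul_apply, Complex.re_sum]
  refine le_trans ?_ (Finset.single_le_sum (f := fun j => (Mᴴ i j * M j i).re) (fun j _ => ?_)
    (Finset.mem_univ i))
  · rw [diagEntry_apply, ← hB, ← hM]
    simp only [conjTranspose_apply, Complex.mul_re, Complex.star_def, Complex.conj_re,
      Complex.conj_im]
    nlinarith [sq_nonneg (M i i).im]
  · simp only [conjTranspose_apply, Complex.mul_re, Complex.star_def, Complex.conj_re,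
      Complex.conj_im]
    nlinarith [sq_nonneg (M j i).im, sq_nonneg (M j i).re]

/-! ### The log-Sobolev inequality and the entropy estimate. -/

theorem dirichlet2_eq {d : ℕ} {T : Mat d →ₗ[ℂ] Mat d} {X : Mat d} (hX : X.IsHermitian) :
    dirichlet2 (hsAdjoint T ∘ₗ T - LinearMap.id) X =
      1 / (d : ℝ) * ((X * X).trace.re - ((T X)ᴴ * T X).trace.re) := by
  have h := trace_hsAdjoint T X (T X)
  rw [hX, trace_mul_comm] at h
  rw [dirichlet2, LinearMap.sub_apply, Matrix.sub_mul, trace_sub, LinearMap.comp_apply, h,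
    LinearMap.id_apply, Complex.sub_re]
  ring

theorem ent2_conjDiag {d : ℕ} (U : unitaryGroup (Fin d) ℂ) (x : Fin d → ℝ) :
    ent2 (conjDiag U x) = 1 / (2 * (d : ℝ)) *
      ∑ i, x i ^ 2 * (Real.log (x i ^ 2 / ∑ j, x j ^ 2) + Real.log d) := by
  have h1 : ((conjDiag U (x ^ 2)).trace)⁻¹ • conjDiag U (x ^ 2) =
      conjDiag U ((∑ j, x j ^ 2)⁻¹ • x ^ 2) := by
    rw [trace_conjDiag, map_smul (conjDiag U), ← Complex.ofReal_inv]
    simp only [Pi.pow_apply]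
    rfl
  rw [ent2, ← map_pow, h1, cfc_conjDiag, ← map_one (conjDiag U), ← map_smul (conjDiag U),
    ← map_add, ← map_mul, trace_conjDiag, Complex.ofReal_re]
  simp [div_eq_inv_mul]

theorem ls2Const_le {d : ℕ} {T : Mat d →ₗ[ℂ] Mat d} {q : ℝ}
    (hq : (q : EReal) ≤ 2 + 2 * discreteLSConst T) {X : Mat d} (hX : X.PosDef)
    (hent : ent2 X ≠ 0) :
    q - 2 ≤ dirichlet2 (hsAdjoint T ∘ₗ T - LinearMap.id) X / ent2 X := by
  set r := dirichlet2 (hsAdjoint T ∘ₗ T - LinearMap.id) X / ent2 X with hr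
  have h1 : ls2Const (hsAdjoint T ∘ₗ T - LinearMap.id) ≤ (r : EReal) :=
    iInf₂_le X ⟨hX, hent⟩
  have h2 : (q : EReal) ≤ 2 + 2 * (((1 / 2 : ℝ) : EReal) * (r : EReal)) := by
    refine hq.trans ?_
    rw [discreteLSConst]
    gcongr
  have h3 : (2 : EReal) + 2 * (((1 / 2 : ℝ) : EReal) * (r : EReal)) =
      ((2 + 2 * (1 / 2 * r) : ℝ) : EReal) := by
    push_cast
    rfl
  rw [h3, EReal.coe_le_coe_iff] at h2
  linarith

/-- A positive unital trace preserving map is a contraction in Hilbert-Schmidt norm on positive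
semidefinite matrices. -/
theorem trace_sq_map_le {d : ℕ} {T : Mat d →ₗ[ℂ] Mat d}
    (hT : ∀ A : Mat d, A.PosSemidef → (T A).PosSemidef) (h1 : T 1 = 1)
    (htr : ∀ X : Mat d, (T X).trace = X.trace) (U : unitaryGroup (Fin d) ℂ) {g : Fin d → ℝ}
    (hg : ∀ i, 0 ≤ g i) :
    ((T (conjDiag U g))ᴴ * T (conjDiag U g)).trace.re ≤ ∑ i, g i ^ 2 := by
  have hB := isHermitian_of_map_posSemidef hT U hg
  -- In the eigenbasis of the image the diagonal entries are its eigenvalues, so scalar Jensen for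
  -- the square applies to them.
  let W := hB.eigenvectorUnitary
  let b := hB.eigenvalues
  have hspec : T (conjDiag U g) = conjDiag W b := hB.spectral_theorem
  have hb : ∀ i, diagEntry T U W i g = b i := by
    intro i
    rw [diagEntry_apply, hspec, conjDiag_apply]
    have : (W : Mat d)ᴴ * ((W : Mat d) * diagonal (fun i => (b i : ℂ)) * (W : Mat d)ᴴ) * W =
        ((W : Mat d)ᴴ * W) * diagonal (fun i => (b i : ℂ)) * ((W : Mat d)ᴴ * W) := by
      simp only [Matrix.mul_assoc]
    rw [this, conjTranspose_mul_unitary, Matrix.one_mul, Matrix.mul_one, diagonal_apply_eq,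
      Complex.ofReal_re]
  have htrace : ((T (conjDiag U g))ᴴ * T (conjDiag U g)).trace.re = ∑ i, b i ^ 2 := by
    rw [hB, hspec, ← map_mul, trace_conjDiag, Complex.ofReal_re]
    simp [sq]
  rw [htrace, ← sum_diagEntry htr U W fun i => g i ^ 2]
  refine Finset.sum_le_sum fun i _ => ?_
  rw [← hb i]
  exact jensen_of_monotone (diagEntry T U W i) (fun g hg => diagEntry_nonneg hT U W i hg)
    (diagEntry_one h1 U W i) (f := fun t => t ^ 2) (convexOn_pow 2) hg

theorem logSobolev_conjDiag {d : ℕ} {T : Mat d →ₗ[ℂ] Mat d}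
    (hT : ∀ A : Mat d, A.PosSemidef → (T A).PosSemidef) (h1 : T 1 = 1)
    (htr : ∀ X : Mat d, (T X).trace = X.trace) {q : ℝ} (hq2 : 2 < q)
    (hq : (q : EReal) ≤ 2 + 2 * discreteLSConst T) (U : unitaryGroup (Fin d) ℂ) {x : Fin d → ℝ}
    (hx : ∀ i, 0 < x i) :
    1 / (d : ℝ) * ((T (conjDiag U x))ᴴ * T (conjDiag U x)).trace.re ≤
      1 / (d : ℝ) * ∑ i, x i ^ 2 - (q - 2) * ent2 (conjDiag U x) := by
  have hE := dirichlet2_eq (T := T) (isHermitian_conjDiag U x)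
  have hXX : (conjDiag U x * conjDiag U x).trace.re = ∑ i, x i ^ 2 := by
    rw [← map_mul, trace_conjDiag, Complex.ofReal_re]
    simp [sq]
  rw [hXX] at hE
  have hE0 : 0 ≤ dirichlet2 (hsAdjoint T ∘ₗ T - LinearMap.id) (conjDiag U x) := by
    rw [hE]
    have := trace_sq_map_le hT h1 htr U fun i => (hx i).le
    exact mul_nonneg (by positivity) (sub_nonneg.2 this)
  have hmain : (q - 2) * ent2 (conjDiag U x) ≤
      dirichlet2 (hsAdjoint T ∘ₗ T - LinearMap.id) (conjDiag U x) := by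
    by_cases hent : ent2 (conjDiag U x) = 0
    · rw [hent, mul_zero]
      exact hE0
    · have h := ls2Const_le hq (posDef_conjDiag U hx) hent
      -- The sign of the entropy comes for free: if it were not positive, the quotient would be at
      -- most `0`, yet it is at least `q - 2 > 0`.
      have hpos : 0 < ent2 (conjDiag U x) := by
        by_contra hneg
        have := div_nonpos_of_nonneg_of_nonpos hE0 (not_lt.1 hneg)
        linarith
      exact (le_div_iff₀ hpos).1 h
  rw [hE] at hmain
  linarith

/-- This replaces differentiation in the exponent: concavity of `log` under the weights `g ^ q / S`
compares `S` with `G`, and `m + 1 ≤ exp m` turns the left side into an exponential. -/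
theorem entropy_le_of_pos {d : ℕ} (hd : 1 ≤ d) {q : ℝ} (hq : 0 ≤ q) {g : Fin d → ℝ}
    (hg : ∀ i, 0 < g i) :
    1 / (d : ℝ) * ∑ i, g i ^ q - (q - 2) * (1 / (2 * (d : ℝ)) *
        ∑ i, g i ^ q * (Real.log (g i ^ q / ∑ j, g j ^ q) + Real.log d)) ≤
      ((∑ i, g i ^ (2 : ℝ)) / d) ^ (q / 2) := by
  have : Nonempty (Fin d) := ⟨⟨0, hd⟩⟩
  have hd0 : (0 : ℝ) < d := by exact_mod_cast hd
  have hS : 0 < ∑ j, g j ^ q :=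
    Finset.sum_pos (fun i _ => Real.rpow_pos_of_pos (hg i) _) Finset.univ_nonempty
  have hG : 0 < ∑ j, g j ^ (2 : ℝ) :=
    Finset.sum_pos (fun i _ => Real.rpow_pos_of_pos (hg i) _) Finset.univ_nonempty
  set S := ∑ j, g j ^ q with hSdef
  set G := ∑ j, g j ^ (2 : ℝ) with hGdef
  set L := ∑ i, g i ^ q / S * Real.log (g i) with hL
  have hw : ∑ i, g i ^ q / S = 1 := by
    rw [← Finset.sum_div, ← hSdef, div_self hS.ne']
  have hent : ∑ i, g i ^ q * (Real.log (g i ^ q / S) + Real.log d) =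
      S * (q * L - Real.log S + Real.log d) := by
    have : ∀ i, g i ^ q * (Real.log (g i ^ q / S) + Real.log d) =
        S * q * (g i ^ q / S * Real.log (g i)) + (Real.log d - Real.log S) * g i ^ q := by
      intro i
      rw [Real.log_div (Real.rpow_pos_of_pos (hg i) _).ne' hS.ne', Real.log_rpow (hg i)]
      field_simp
      ring
    simp only [this, Finset.sum_add_distrib, ← Finset.mul_sum, ← hL, ← hSdef]
    ring
  have hlog : (2 - q) * L ≤ Real.log (G / S) := by
    have h := strictConcaveOn_log_Ioi.concaveOn.le_map_sum (t := Finset.univ)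
      (w := fun i => g i ^ q / S) (p := fun i => g i ^ (2 - q))
      (fun i _ => div_nonneg (Real.rpow_nonneg (hg i).le _) hS.le) hw
      (fun i _ => Real.rpow_pos_of_pos (hg i) _)
    simp only [smul_eq_mul] at h
    have e1 : ∑ i, g i ^ q / S * Real.log (g i ^ (2 - q)) = (2 - q) * L := by
      rw [hL, Finset.mul_sum]
      refine Finset.sum_congr rfl fun i _ => ?_
      rw [Real.log_rpow (hg i)]
      ring
    have e2 : ∑ i, g i ^ q / S * g i ^ (2 - q) = G / S := by
      rw [hGdef, Finset.sum_div]
      refine Finset.sum_congr rfl fun i _ => ?_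
      rw [div_mul_eq_mul_div, ← Real.rpow_add (hg i)]
      congr 2
      ring
    rwa [e1, e2] at h
  set m := -((q - 2) / 2) * (q * L - Real.log S + Real.log d) with hm
  calc 1 / (d : ℝ) * S - (q - 2) * (1 / (2 * (d : ℝ)) *
        ∑ i, g i ^ q * (Real.log (g i ^ q / S) + Real.log d)) = S / d * (m + 1) := by
        rw [hent, hm]
        field_simp
        ring
    _ ≤ S / d * Real.exp m :=
        mul_le_mul_of_nonneg_left (Real.add_one_le_exp m) (div_nonneg hS.le hd0.le)
    _ = Real.exp (Real.log (S / d) + m) := by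
        rw [Real.exp_add, Real.exp_log (div_pos hS hd0)]
    _ ≤ Real.exp (Real.log (G / d) * (q / 2)) := by
        refine Real.exp_le_exp.2 ?_
        rw [Real.log_div hG.ne' hS.ne'] at hlog
        rw [Real.log_div hG.ne' hd0.ne', Real.log_div hS.ne' hd0.ne', hm]
        nlinarith [mul_le_mul_of_nonneg_right hlog (by linarith : 0 ≤ q / 2)]
    _ = (G / d) ^ (q / 2) := (Real.rpow_def_of_pos (div_pos hG hd0) _).symm

/-! ### Hypercontractivity on positive definite matrices. -/

/-- The bound `‖T X‖_q ≤ ‖X‖₂` for `X` positive definite, tested on the diagonal of `T X` in an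
arbitrary orthonormal basis. -/
theorem sum_rpow_diagEntry_le {d : ℕ} (hd : 1 ≤ d) {T : Mat d →ₗ[ℂ] Mat d}
    (hT : ∀ A : Mat d, A.PosSemidef → (T A).PosSemidef) (h1 : T 1 = 1)
    (htr : ∀ X : Mat d, (T X).trace = X.trace) {q : ℝ} (hq1 : 1 ≤ q)
    (hq : (q : EReal) ≤ 2 + 2 * discreteLSConst T) (U W : unitaryGroup (Fin d) ℂ) {g : Fin d → ℝ}
    (hg : ∀ i, 0 < g i) :
    ∑ i, diagEntry T U W i g ^ q ≤ d * ((∑ i, g i ^ (2 : ℝ)) / d) ^ (q / 2) := by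
  have hd0 : (0 : ℝ) < d := by exact_mod_cast hd
  have hjensen : ∀ r : ℝ, 1 ≤ r → ∀ i,
      diagEntry T U W i g ^ r ≤ diagEntry T U W i (fun j => g j ^ r) := fun r hr i =>
    jensen_of_monotone (diagEntry T U W i) (fun g hg => diagEntry_nonneg hT U W i hg)
      (diagEntry_one h1 U W i) (convexOn_rpow hr) fun j => (hg j).le
  rcases le_or_gt q 2 with hq2 | hq2
  · have hq0 : 0 < q := by linarith
    have hmean := Real.arith_mean_le_rpow_mean Finset.univ (fun _ : Fin d => (1 / d : ℝ))
      (fun i => g i ^ q) (fun i _ => by positivity) (by simp [hd0.ne'])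
      (fun i _ => Real.rpow_nonneg (hg i).le _) (p := 2 / q) ((one_le_div hq0).2 hq2)
    have e : ∀ i, (g i ^ q) ^ (2 / q) = g i ^ (2 : ℝ) := fun i => by
      rw [← Real.rpow_mul (hg i).le, mul_div_cancel₀ _ hq0.ne']
    simp only [e, ← Finset.mul_sum, one_div_div] at hmean
    calc ∑ i, diagEntry T U W i g ^ q ≤ ∑ i, diagEntry T U W i (fun j => g j ^ q) :=
          Finset.sum_le_sum fun i _ => hjensen q hq1 i
      _ = d * (1 / d * ∑ i, g i ^ q) := by
          rw [sum_diagEntry htr]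
          field_simp
      _ ≤ d * (1 / d * ∑ i, g i ^ (2 : ℝ)) ^ (q / 2) := mul_le_mul_of_nonneg_left hmean hd0.le
      _ = _ := by rw [one_div_mul_eq_div]
  · set x : Fin d → ℝ := fun j => g j ^ (q / 2) with hxdef
    have hx : ∀ i, 0 < x i := fun i => Real.rpow_pos_of_pos (hg i) _
    have hx2 : ∀ i, x i ^ 2 = g i ^ q := fun i => by
      rw [hxdef, ← Real.rpow_natCast, ← Real.rpow_mul (hg i).le]
      norm_num
    have hnn : ∀ i, 0 ≤ diagEntry T U W i g := fun i =>
      diagEntry_nonneg hT U W i fun j => (hg j).le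
    have hls := logSobolev_conjDiag hT h1 htr hq2 hq U hx
    have hent := entropy_le_of_pos hd (q := q) (by linarith) hg
    rw [ent2_conjDiag] at hls
    simp only [hx2] at hls
    have hstep : ∑ i, diagEntry T U W i g ^ q ≤
        ((T (conjDiag U x))ᴴ * T (conjDiag U x)).trace.re := by
      refine le_trans (Finset.sum_le_sum fun i _ => ?_) (sum_sq_diagEntry_le T U W x)
      calc diagEntry T U W i g ^ q = (diagEntry T U W i g ^ (q / 2)) ^ 2 := by
            rw [← Real.rpow_natCast, ← Real.rpow_mul (hnn i)]
            norm_num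
        _ ≤ diagEntry T U W i x ^ 2 :=
            pow_le_pow_left₀ (Real.rpow_nonneg (hnn i) _) (hjensen (q / 2) (by linarith) i) 2
    calc ∑ i, diagEntry T U W i g ^ q
        ≤ d * (1 / d * ((T (conjDiag U x))ᴴ * T (conjDiag U x)).trace.re) := by
          refine hstep.trans (le_of_eq ?_)
          field_simp
      _ ≤ _ := mul_le_mul_of_nonneg_left (hls.trans hent) hd0.le

/-! ### From positive definite to arbitrary matrices. -/

/-- The `(a, c)` block of a matrix on `Fin 2 × Fin d`. -/
def block {d : ℕ} (M : Matrix (Fin 2 × Fin d) (Fin 2 × Fin d) ℂ) (a c : Fin 2) : Mat d :=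
  Matrix.of fun i j => M (a, i) (c, j)

theorem block_add_smul_one {d : ℕ} (M : Matrix (Fin 2 × Fin d) (Fin 2 × Fin d) ℂ) (e : ℂ)
    (a c : Fin 2) : block (M + e • 1) a c = block M a c + if a = c then e • 1 else 0 := by
  ext i j
  by_cases h : a = c <;> simp [block, h, Matrix.one_apply]

theorem sq_le_of_block_posSemidef {d : ℕ} {M : Matrix (Fin 2 × Fin d) (Fin 2 × Fin d) ℂ}
    (hM : M.PosSemidef) (R : Fin 2 → Mat d) (i : Fin d) :
    (((R 0)ᴴ * block M 0 1 * R 1) i i).re ^ 2 ≤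
      (((R 0)ᴴ * block M 0 0 * R 0) i i).re * (((R 1)ᴴ * block M 1 1 * R 1) i i).re := by
  -- Compressing by the `i`-th columns of `R 0` and `R 1`, one in each block, leaves a `2 × 2`
  -- positive semidefinite matrix; its determinant gives the bound.
  let Q : Matrix (Fin 2 × Fin d) (Fin 2) ℂ :=
    Matrix.of fun x a => if x.1 = a then R a x.2 i else 0
  have hQ : ∀ a c, (Qᴴ * M * Q) a c = ((R a)ᴴ * block M a c * R c) i i := by
    intro a c
    simp only [Matrix.mul_apply, conjTranspose_apply, Q, block, Matrix.of_apply,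
      Fintype.sum_prod_type]
    rw [Finset.sum_eq_single c]
    · refine Finset.sum_congr rfl fun j _ => ?_
      rw [Finset.sum_eq_single a]
      · simp
      · intro b _ hb
        simp [hb]
      · simp
    · intro b _ hb
      simp [hb]
    · simp
  have hP := hM.conjTranspose_mul_mul_same Q
  set P := Qᴴ * M * Q with hPdef
  have hdet : 0 ≤ P.det := hP.det_nonneg
  have h00 := Complex.nonneg_iff.1 (hP.diag_nonneg (i := 0))
  have h11 := Complex.nonneg_iff.1 (hP.diag_nonneg (i := 1))
  have h10 : P 1 0 = star (P 0 1) := (hP.isHermitian.apply 1 0).symm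
  rw [det_fin_two, h10] at hdet
  have hre := (Complex.nonneg_iff.1 hdet).1
  simp only [Complex.sub_re, Complex.mul_re, Complex.star_def, Complex.conj_re, Complex.conj_im,
    ← h00.2, ← h11.2] at hre
  rw [← hQ, ← hQ, ← hQ]
  nlinarith [sq_nonneg (P 0 1).im]

theorem map_posSemidef_of_completelyPositive {d : ℕ} {T : Mat d →ₗ[ℂ] Mat d}
    (hT : IsCompletelyPositive T) (A : Mat d) (hA : A.PosSemidef) : (T A).PosSemidef :=
  (hT 1 _ (hA.submatrix (Prod.snd : Fin 1 × Fin d → Fin d))).submatrix fun i => (0, i)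

/-- Kadison-Schwarz type bound for the singular values of `T Y`. -/
theorem singularValue_sq_le {d : ℕ} {T : Mat d →ₗ[ℂ] Mat d} (hT : IsCompletelyPositive T)
    (W V W' V' : unitaryGroup (Fin d) ℂ) {s t : Fin d → ℝ} (ht : ∀ i, 0 ≤ t i)
    (h : T ((W' : Mat d) * diagonal (fun i => (t i : ℂ)) * (V' : Mat d)ᴴ) =
      (W : Mat d) * diagonal (fun i => (s i : ℂ)) * (V : Mat d)ᴴ) {e : ℝ} (he : 0 ≤ e) (i : Fin d) :
    s i ^ 2 ≤ diagEntry T W' W i (fun i => t i + e) * diagEntry T V' V i (fun i => t i + e) := by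
  let R' : Fin 2 → Mat d := ![(W' : Mat d), (V' : Mat d)]
  let R : Fin 2 → Mat d := ![(W : Mat d), (V : Mat d)]
  -- With `W'` stacked on `V'`, the blocks of `N diag(t) N*` are `|Y*|`, `Y`, `Y*`, `|Y|`. Adding `e
  -- • 1` makes the diagonal blocks definite when `e > 0` and leaves the off-diagonal `Y` untouched.
  let N : Matrix (Fin 2 × Fin d) (Fin d) ℂ := Matrix.of fun x k => R' x.1 x.2 k
  let M₀ := N * diagonal (fun i => (t i : ℂ)) * Nᴴ
  let M := M₀ + (e : ℂ) • 1
  have hblock : ∀ a c, block M₀ a c = R' a * diagonal (fun i => (t i : ℂ)) * (R' c)ᴴ := by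
    intro a c
    ext i j
    simp only [block, M₀, Matrix.mul_apply, conjTranspose_apply, N, Matrix.of_apply]
  have hM : M.PosSemidef := by
    refine PosSemidef.add (PosSemidef.mul_mul_conjTranspose_same
      (posSemidef_diagonal_iff.2 fun i => ?_) _) (PosSemidef.one.smul ?_)
    · exact_mod_cast ht i
    · exact_mod_cast he
  have hdiag : ∀ U : unitaryGroup (Fin d) ℂ,
      (U : Mat d) * diagonal (fun i => (t i : ℂ)) * (U : Mat d)ᴴ + (e : ℂ) • 1 =
        conjDiag U (fun i => t i + e) := by
    intro U
    have : (fun i => t i + e) = t + e • (1 : Fin d → ℝ) := by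
      ext i
      simp
    rw [this, map_add, map_smul (conjDiag U), map_one]
    rfl
  have hamp : ∀ a c, block (ampliation T 2 M) a c = T (block M a c) := fun _ _ => rfl
  have hmain := sq_le_of_block_posSemidef (hT 2 M hM) R i
  rw [hamp, hamp, hamp, block_add_smul_one, block_add_smul_one, block_add_smul_one, hblock, hblock,
    hblock] at hmain
  have h01 : (0 : Fin 2) ≠ 1 := by decide
  simp only [R, R', cons_val_zero, cons_val_one, if_true, if_neg h01, add_zero, h, hdiag] at hmain
  have hs : (W : Mat d)ᴴ * ((W : Mat d) * diagonal (fun i => (s i : ℂ)) * (V : Mat d)ᴴ) * V =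
      diagonal (fun i => (s i : ℂ)) := by
    calc _ = ((W : Mat d)ᴴ * W) * diagonal (fun i => (s i : ℂ)) * ((V : Mat d)ᴴ * V) := by
          simp only [Matrix.mul_assoc]
      _ = _ := by
          rw [conjTranspose_mul_unitary, conjTranspose_mul_unitary, Matrix.one_mul, Matrix.mul_one]
  rw [hs, diagonal_apply_eq, Complex.ofReal_re] at hmain
  exact hmain

theorem sum_rpow_singularValue_le {d : ℕ} (hd : 1 ≤ d) {T : Mat d →ₗ[ℂ] Mat d}
    (hT : IsDoublyStochasticChannel T) {q : ℝ} (hq1 : 1 ≤ q)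
    (hq : (q : EReal) ≤ 2 + 2 * discreteLSConst T)
    (W V W' V' : unitaryGroup (Fin d) ℂ) {s t : Fin d → ℝ} (hs : ∀ i, 0 ≤ s i) (ht : ∀ i, 0 ≤ t i)
    (h : T ((W' : Mat d) * diagonal (fun i => (t i : ℂ)) * (V' : Mat d)ᴴ) =
      (W : Mat d) * diagonal (fun i => (s i : ℂ)) * (V : Mat d)ᴴ) :
    ∑ i, s i ^ q ≤ d * ((∑ i, t i ^ (2 : ℝ)) / d) ^ (q / 2) := by
  have hCP := hT.channel.completelyPositive
  have hpos := map_posSemidef_of_completelyPositive hCP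
  have hq0 : 0 ≤ q / 2 := by linarith
  -- The log-Sobolev inequality is available only for strictly positive matrices, hence the shift by
  -- `e`, removed at the end by continuity.
  have hbound : ∀ e : ℝ, 0 < e →
      ∑ i, s i ^ q ≤ d * ((∑ i, (t i + e) ^ (2 : ℝ)) / d) ^ (q / 2) := by
    intro e he
    have hg : ∀ i, 0 < t i + e := fun i => add_pos_of_nonneg_of_pos (ht i) he
    have hA := sum_rpow_diagEntry_le hd hpos hT.map_one hT.channel.trace_preserving hq1 hq W' W hg
    have hB := sum_rpow_diagEntry_le hd hpos hT.map_one hT.channel.trace_preserving hq1 hq V' V hg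
    have hstep : ∀ i, s i ^ q ≤ (diagEntry T W' W i (fun i => t i + e) ^ q +
        diagEntry T V' V i (fun i => t i + e) ^ q) / 2 := by
      intro i
      have ha := diagEntry_nonneg hpos W' W i fun i => (hg i).le
      have hb := diagEntry_nonneg hpos V' V i fun i => (hg i).le
      have hab := singularValue_sq_le hCP W V W' V' ht h he.le i
      set a := diagEntry T W' W i (fun i => t i + e)
      set b := diagEntry T V' V i (fun i => t i + e)
      have e1 : ∀ x : ℝ, 0 ≤ x → (x ^ (q / 2)) ^ 2 = x ^ q := fun x hx => by
        rw [← Real.rpow_natCast, ← Real.rpow_mul hx]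
        norm_num
      calc s i ^ q = (s i ^ 2) ^ (q / 2) := by
            rw [← Real.rpow_natCast, ← Real.rpow_mul (hs i)]
            congr 1
            push_cast
            ring
        _ ≤ (a * b) ^ (q / 2) := Real.rpow_le_rpow (sq_nonneg _) hab hq0
        _ = a ^ (q / 2) * b ^ (q / 2) := Real.mul_rpow ha hb
        -- AM-GM separates the two factors; both sums then have the same bound, because `|Y*|` and
        -- `|Y|` share the eigenvalues `t`.
        _ ≤ (a ^ q + b ^ q) / 2 := by
            rw [← e1 a ha, ← e1 b hb]
            nlinarith [sq_nonneg (a ^ (q / 2) - b ^ (q / 2))]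
    refine (Finset.sum_le_sum fun i _ => hstep i).trans ?_
    rw [← Finset.sum_div, Finset.sum_add_distrib]
    linarith
  have hcont : Continuous fun e : ℝ => (d : ℝ) * ((∑ i, (t i + e) ^ (2 : ℝ)) / d) ^ (q / 2) := by
    refine continuous_const.mul (Continuous.rpow_const ?_ fun _ => Or.inr hq0)
    refine Continuous.div_const (continuous_finsetSum _ fun i _ => ?_) _
    exact (continuous_const.add continuous_id).rpow_const fun _ => Or.inr (by norm_num)
  have hlim := (hcont.tendsto 0).mono_left (nhdsWithin_le_nhds (s := Set.Ioi 0))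
  have := ge_of_tendsto hlim (Filter.eventually_of_mem self_mem_nhdsWithin hbound)
  simpa only [add_zero] using this

end QHyper

theorem theorem4p6 (d : ℕ) (hd : 1 ≤ d) (T : QHyper.Mat d →ₗ[ℂ] QHyper.Mat d)
    (hT : QHyper.IsDoublyStochasticChannel T)
    (hprim : QHyper.IsPrimitive (QHyper.hsAdjoint T ∘ₗ T))
    (q : ℝ) (hq1 : 1 ≤ q)
    (hq : (q : EReal) ≤ 2 + 2 * QHyper.discreteLSConst T) :
    QHyper.opNorm 2 q T ≤ 1 := by
  refine iSup₂_le fun Y _ => ?_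
  obtain ⟨W', V', t, ht, hY⟩ := QHyper.exists_singularValueDecomposition Y
  obtain ⟨W, V, s, hs, hTY⟩ := QHyper.exists_singularValueDecomposition (T Y)
  have hd0 : (0 : ℝ) < d := by exact_mod_cast hd
  have hq0 : 0 < q := by linarith
  have ht2 : 0 ≤ ∑ i, t i ^ (2 : ℝ) := Finset.sum_nonneg fun i _ => Real.rpow_nonneg (ht i) _
  have hs2 : 0 ≤ ∑ i, s i ^ q := Finset.sum_nonneg fun i _ => Real.rpow_nonneg (hs i) _
  have hsum := QHyper.sum_rpow_singularValue_le hd hT hq1 hq W V W' V' hs ht (hY ▸ hTY)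
  have hnorm : ∀ (p x : ℝ), 0 ≤ x → 1 / (d : ℝ) ^ (1 / p) * x ^ (1 / p) = (x / d) ^ (1 / p) :=
    fun p x hx => by rw [Real.div_rpow hx hd0.le, one_div_mul_eq_div]
  have hle : QHyper.wnorm q (T Y) ≤ QHyper.wnorm 2 Y := by
    rw [hTY, hY, QHyper.wnorm_eq q W V hs, QHyper.wnorm_eq 2 W' V' ht, hnorm q _ hs2,
      hnorm 2 _ ht2]
    calc ((∑ i, s i ^ q) / d) ^ (1 / q)
        ≤ (((∑ i, t i ^ (2 : ℝ)) / d) ^ (q / 2)) ^ (1 / q) :=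
          Real.rpow_le_rpow (div_nonneg hs2 hd0.le) ((div_le_iff₀' hd0).2 hsum) (by positivity)
      _ = ((∑ i, t i ^ (2 : ℝ)) / d) ^ (1 / 2 : ℝ) := by
          rw [← Real.rpow_mul (div_nonneg ht2 hd0.le)]
          congr 1
          field_simp
  have h0 : 0 ≤ QHyper.wnorm 2 Y := by
    rw [hY, QHyper.wnorm_eq 2 W' V' ht, hnorm 2 _ ht2]
    exact Real.rpow_nonneg (div_nonneg ht2 hd0.le) _
  exact ENNReal.ofReal_le_one.2 (div_le_one_of_le₀ hle h0)
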